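/- Let $n\ge 3$ and $k\ge 1$. A real $(n,k)$-frame is a family $F=\{f_1,\dots,f_n\}$ in $\mathbb R^k$ with $\sum_j|\langle x,f_j\rangle|^2=\|x\|^2$ for all $x\in\mathbb R^k$; its analysis operator is $V:\mathbb R^k\to\mathbb R^n$, $(Vx)_j=\langle x,f_j\rangle$. Let $\mathcal D_m$ be the set of diagonal $n\times n$ matrices with exactly $m$ diagonal entries equal to $1$ and the others equal to $0$. The frame is called 2-uniform if all $\|f_j\|$ are equal and the operator norm $\|V^*DV\|$ is the same for all $D\in\mathcal D_2$. For $p\ge 1$ put $$e_m^p(F)=\Bigl\{\tbinom nm^{-1}\sum_{D\in\mathcal D_m}\|V^*DV\|^p\Bigr\}^{1/p},\qquad c_{n,k}=\sqrt{\frac{k(n-k)}{n^2(n-1)}}.$$ A graph $G$ on $\{1,\dots,n\}$ is a graph of $F$ if $VV^*=\frac kn I+c_{n,k}Q$, where $Q$ is the Seidel adjacency matrix of $G$ (entries $0$ on the diagonal, $-1$ for adjacent and $+1$ for distinct non-adjacent vertices). Let $E_3(G)$ and $O_3(G)$ be the numbers of 3-element vertex sets whose induced subgraph has an even, respectively odd,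 number of edges. Let $F$ be a real 2-uniform $(n,k)$-frame. Then $F$ has a graph, and exactly one if $k<n$. For every graph $G$ of $F$: (a) $E_3(G)$ is also the number of 3-element vertex sets whose induced subgraph is complete bipartite (where one of the two parts may be empty); (b) for all real $p$ with $2\le p<\infty$, $$e_3^p(F)=\Bigl(\tbinom n3^{-1}\Bigl[\bigl(\tfrac kn+2c_{n,k}\bigr)^pE_3(G)+\bigl(\tfrac kn+c_{n,k}\bigr)^pO_3(G)\Bigr]\Bigr)^{1/p};$$ (c) if $k<n$, then $$O_3(G)=\frac{v(n-1)c}{6}+(n-2v+c)\frac{(n-1)v}{2},\qquad E_3(G)=\binom n3-\frac{v(n-1)c}{6}-(n-2v+c)\frac{(n-1)v}{2},$$ where $$v=\tfrac12\Bigl(n-2-\sqrt{\tfrac{(n-k)(n-1)}{k}}+\sqrt{\tfrac{k(n-1)}{n-k}}\Bigr),\qquad c=v-1-\tfrac14\Bigl(\sqrt{\tfrac{(n-k)(n-1)}{k}}-1\Bigr)\Bigl(\sqrt{\tfrac{k(n-1)}{n-k}}+1\Bigr).$$ Consequently, for any two real 2-uniform $(n,k)$-frames $F_1,F_2$ and all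 $2\le p<\infty$, $e_3^p(F_1)=e_3^p(F_2)$. -/

import Mathlib

/-- A finite family `F` in `ℝᵏ` is a Parseval frame: `‖x‖² = ∑ⱼ |⟨x, fⱼ⟩|²` for all `x`.
A real `(n,k)`-frame is a Parseval frame for `ℝᵏ` consisting of `n` vectors. -/
def IsParsevalFrame {n k : ℕ} (F : Fin n → EuclideanSpace ℝ (Fin k)) : Prop :=
  ∀ x : EuclideanSpace ℝ (Fin k), ∑ j, |inner ℝ x (F j)| ^ 2 = ‖x‖ ^ 2

/-- All the vectors of the family have the same norm. -/
def IsUniformFamily {n k : ℕ} (F : Fin n → EuclideanSpace ℝ (Fin k)) : Prop :=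
  ∃ c : ℝ, ∀ j, ‖F j‖ = c

/-- The analysis operator `V : ℝᵏ → ℝⁿ`, `(V x)ⱼ = ⟨x, fⱼ⟩`. -/
noncomputable def analysisOp {n k : ℕ} (F : Fin n → EuclideanSpace ℝ (Fin k)) :
    EuclideanSpace ℝ (Fin k) →L[ℝ] EuclideanSpace ℝ (Fin n) :=
  LinearMap.toContinuousLinearMap
    { toFun := fun x => WithLp.toLp 2 (fun j => inner ℝ x (F j))
      map_add' := fun x y => by ext j; simp [inner_add_left]
      map_smul' := fun a x => by ext j; simp [inner_smul_left] }

/-- The operator on `ℝⁿ` given by the diagonal matrix that has the entry `1` at the positions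
in `S` and `0` elsewhere. -/
noncomputable def diagOp {n : ℕ} (S : Finset (Fin n)) :
    EuclideanSpace ℝ (Fin n) →L[ℝ] EuclideanSpace ℝ (Fin n) :=
  Matrix.toEuclideanCLM (n := Fin n) (𝕜 := ℝ)
    (Matrix.diagonal (fun i => if i ∈ S then (1 : ℝ) else 0))

/-- The error operator `V* D V` on `ℝᵏ`, where `D` is the diagonal matrix whose ones are at the
(erased) positions in `S`. -/
noncomputable def errorOp {n k : ℕ} (F : Fin n → EuclideanSpace ℝ (Fin k))
    (S : Finset (Fin n)) : EuclideanSpace ℝ (Fin k) →L[ℝ] EuclideanSpace ℝ (Fin k) :=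
  (ContinuousLinearMap.adjoint (analysisOp F)).comp ((diagOp S).comp (analysisOp F))

/-- `e_m^p(F) = ( (n choose m)⁻¹ ∑_D ‖V* D V‖ᵖ )^(1/p)`, the sum being over all diagonal `0`-`1`
matrices `D` with exactly `m` ones, that is, over all `m`-element sets of positions; `‖·‖` is the
operator norm. -/
noncomputable def erasureError (m : ℕ) (p : ℝ) {n k : ℕ}
    (F : Fin n → EuclideanSpace ℝ (Fin k)) : ℝ :=
  (((n.choose m : ℝ))⁻¹ *
    ∑ S ∈ Finset.powersetCard m (Finset.univ : Finset (Fin n)), ‖errorOp F S‖ ^ p) ^ (1 / p)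

/-- A real 2-uniform `(n,k)`-frame: a uniform Parseval frame such that `‖V* D V‖` is the same
for all diagonal `0`-`1` matrices `D` with exactly two ones. -/
def IsTwoUniformFrame {n k : ℕ} (F : Fin n → EuclideanSpace ℝ (Fin k)) : Prop :=
  IsParsevalFrame F ∧ IsUniformFamily F ∧
    ∃ c : ℝ, ∀ S : Finset (Fin n), S.card = 2 → ‖errorOp F S‖ = c

/-- `c_{n,k} = √(k(n-k) / (n²(n-1)))`. -/
noncomputable def frameAngle (n k : ℕ) : ℝ :=
  Real.sqrt ((k : ℝ) * ((n : ℝ) - k) / ((n : ℝ) ^ 2 * ((n : ℝ) - 1)))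

open Classical in
/-- The Seidel adjacency matrix of a graph: `0` on the diagonal, `-1` at adjacent pairs, `+1` at
pairs of distinct non-adjacent vertices. -/
noncomputable def seidelMatrix {V : Type*} (G : SimpleGraph V) : Matrix V V ℝ :=
  Matrix.of fun i j => if i = j then 0 else if G.Adj i j then -1 else 1

/-- `G` is a graph of the frame `F`: the Gram matrix `VV* = (⟨fⱼ, fᵢ⟩)` is
`(k/n) I + c_{n,k} Q` with `Q` the Seidel adjacency matrix of `G`. -/
def IsGraphOfFrame {n k : ℕ} (F : Fin n → EuclideanSpace ℝ (Fin k))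
    (G : SimpleGraph (Fin n)) : Prop :=
  (Matrix.of fun i j => (inner ℝ (F j) (F i) : ℝ)) =
    ((k : ℝ) / n) • (1 : Matrix (Fin n) (Fin n) ℝ) + frameAngle n k • seidelMatrix G

/-- A graph is complete bipartite if its vertex set is the union of two disjoint sets `A` and
`Aᶜ`, one of which may be empty, such that two vertices are adjacent exactly when they lie in
different ones of the two sets. -/
def IsCompleteBipartiteGraph {V : Type*} (G : SimpleGraph V) : Prop :=
  ∃ A : Set V, ∀ u v : V, G.Adj u v ↔ ((u ∈ A ∧ v ∉ A) ∨ (u ∉ A ∧ v ∈ A))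

open Classical in
/-- The number of 3-vertex subsets whose induced subgraph is complete bipartite. -/
noncomputable def numBipartite3 {n : ℕ} (G : SimpleGraph (Fin n)) : ℕ :=
  ((Finset.powersetCard 3 (Finset.univ : Finset (Fin n))).filter
    (fun S => IsCompleteBipartiteGraph (G.induce (S : Set (Fin n))))).card

open Classical in
/-- `E₃(G)`: the number of 3-vertex subsets whose induced subgraph has an even number of edges. -/
noncomputable def numEven3 {n : ℕ} (G : SimpleGraph (Fin n)) : ℕ :=
  ((Finset.powersetCard 3 (Finset.univ : Finset (Fin n))).filter
    (fun S => Even (G.induce (S : Set (Fin n))).edgeSet.ncard)).card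

open Classical in
/-- `O₃(G)`: the number of 3-vertex subsets whose induced subgraph has an odd number of edges. -/
noncomputable def numOdd3 {n : ℕ} (G : SimpleGraph (Fin n)) : ℕ :=
  ((Finset.powersetCard 3 (Finset.univ : Finset (Fin n))).filter
    (fun S => Odd (G.induce (S : Set (Fin n))).edgeSet.ncard)).card

/-- `v = ½ (n - 2 - √((n-k)(n-1)/k) + √(k(n-1)/(n-k)))`. -/
noncomputable def valencyConst (n k : ℕ) : ℝ :=
  1 / 2 * ((n : ℝ) - 2 - Real.sqrt (((n : ℝ) - k) * ((n : ℝ) - 1) / k)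
    + Real.sqrt ((k : ℝ) * ((n : ℝ) - 1) / ((n : ℝ) - k)))

/-- `c = v - 1 - ¼ (√((n-k)(n-1)/k) - 1) (√(k(n-1)/(n-k)) + 1)`. -/
noncomputable def commonNbrConst (n k : ℕ) : ℝ :=
  valencyConst n k - 1
    - 1 / 4 * (Real.sqrt (((n : ℝ) - k) * ((n : ℝ) - 1) / k) - 1)
      * (Real.sqrt ((k : ℝ) * ((n : ℝ) - 1) / ((n : ℝ) - k)) + 1)

/-- The value of `O₃` in terms of `n` and `k`: `v(n-1)c/6 + (n-2v+c)(n-1)v/2`. -/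
noncomputable def oddConst (n k : ℕ) : ℝ :=
  valencyConst n k * ((n : ℝ) - 1) * commonNbrConst n k / 6
    + ((n : ℝ) - 2 * valencyConst n k + commonNbrConst n k)
      * (((n : ℝ) - 1) * valencyConst n k / 2)

/-- The value of `E₃` in terms of `n` and `k`:
`(n choose 3) - v(n-1)c/6 - (n-2v+c)(n-1)v/2`. -/
noncomputable def evenConst (n k : ℕ) : ℝ :=
  (n.choose 3 : ℝ)
    - valencyConst n k * ((n : ℝ) - 1) * commonNbrConst n k / 6
    - ((n : ℝ) - 2 * valencyConst n k + commonNbrConst n k)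
      * (((n : ℝ) - 1) * valencyConst n k / 2)

/-! Write r = k/n and c = `frameAngle n k`. Since D is a self-adjoint idempotent, V*DV = TT* with T
= V*D, so its norm is the top eigenvalue of the Gram matrix of the erased vectors
(`norm_errorOp_eq`). For two erasures this is r + |⟨fᵢ,fⱼ⟩|; hence 2-uniformity means
equiangularity, Parseval fixes the common modulus as c, and the signs of the inner products define
the graph. For three erasures the Gram matrix is r I + c Q₃ with Q₃ a 3×3 Seidel matrix. Its top
eigenvalue is 2 or 1 according to whether the product of the three signs is 1 or -1
(`norm_errorOp_triple`), and that product is the parity of the edge number (`induce_triple_parity`).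
This gives the error formula. The counts follow from E₃ + O₃ = (n choose 3) and from tr Q³ = 6(E₃ -
O₃), which is known because the Gram matrix P is a projection, so tr P³ = tr P
(`IsGraphOfFrame.frameAngle_mul_sub`). -/

/-! ### Norms of error operators -/

theorem errorOp_eq {n k : ℕ} (F : Fin n → EuclideanSpace ℝ (Fin k)) (S : Finset (Fin n)) :
    errorOp F S = ((ContinuousLinearMap.adjoint (analysisOp F)).comp (diagOp S)).comp
      (ContinuousLinearMap.adjoint
        ((ContinuousLinearMap.adjoint (analysisOp F)).comp (diagOp S))) := by
  have hsa : ContinuousLinearMap.adjoint (diagOp S) = diagOp S := by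
    rw [← ContinuousLinearMap.star_eq_adjoint, diagOp, ← map_star]
    congr 1
    rw [Matrix.star_eq_conjTranspose, Matrix.diagonal_conjTranspose]
    congr 1
  have hidem : (diagOp S).comp (diagOp S) = diagOp S := by
    change diagOp S * diagOp S = diagOp S
    rw [diagOp, ← map_mul, Matrix.diagonal_mul_diagonal]
    congr 2
    funext i
    split_ifs <;> simp
  rw [ContinuousLinearMap.adjoint_comp, ContinuousLinearMap.adjoint_adjoint, hsa,
    ContinuousLinearMap.comp_assoc, ← ContinuousLinearMap.comp_assoc (diagOp S) (diagOp S), hidem]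
  rfl

theorem adjoint_analysisOp_comp_diagOp_apply {n k : ℕ} (F : Fin n → EuclideanSpace ℝ (Fin k))
    (S : Finset (Fin n)) (y : EuclideanSpace ℝ (Fin n)) :
    (ContinuousLinearMap.adjoint (analysisOp F)).comp (diagOp S) y = ∑ i ∈ S, y i • F i := by
  refine ext_inner_left ℝ fun x => ?_
  rw [ContinuousLinearMap.comp_apply, ContinuousLinearMap.adjoint_inner_right, inner_sum,
    PiLp.inner_apply, ← Finset.sum_filter_add_sum_filter_not Finset.univ (· ∈ S)]
  have h (i : Fin n) : (diagOp S y) i = if i ∈ S then y i else 0 := by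
    simp [diagOp, Matrix.mulVec_diagonal]
  rw [Finset.sum_eq_zero (s := Finset.univ.filter (· ∉ S)), add_zero,
    Finset.filter_mem_eq_inter, Finset.univ_inter]
  · refine Finset.sum_congr rfl fun i hi => ?_
    rw [h, if_pos hi, inner_smul_right]
    simp [analysisOp]
  · intro i hi
    rw [h, if_neg (Finset.mem_filter.1 hi).2]
    simp

theorem norm_sum_smul_sq {n k : ℕ} (F : Fin n → EuclideanSpace ℝ (Fin k))
    (S : Finset (Fin n)) (y : Fin n → ℝ) :
    ‖∑ i ∈ S, y i • F i‖ ^ 2 = ∑ i ∈ S, ∑ j ∈ S, y i * y j * inner ℝ (F i) (F j) := by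
  rw [← real_inner_self_eq_norm_sq, sum_inner]
  refine Finset.sum_congr rfl fun i _ => ?_
  rw [inner_sum]
  refine Finset.sum_congr rfl fun j _ => ?_
  rw [real_inner_smul_left, real_inner_smul_right]
  ring

/-- The norm of the error operator is the maximum of the Rayleigh quotient of the Gram matrix of
the erased vectors. -/
theorem norm_errorOp_eq {n k : ℕ} (F : Fin n → EuclideanSpace ℝ (Fin k)) (S : Finset (Fin n))
    (l : ℝ)
    (hle : ∀ y : Fin n → ℝ,
      ∑ i ∈ S, ∑ j ∈ S, y i * y j * inner ℝ (F i) (F j) ≤ l * ∑ i ∈ S, y i ^ 2)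
    (hex : ∃ y : Fin n → ℝ, 0 < ∑ i ∈ S, y i ^ 2 ∧
      ∑ i ∈ S, ∑ j ∈ S, y i * y j * inner ℝ (F i) (F j) = l * ∑ i ∈ S, y i ^ 2) :
    ‖errorOp F S‖ = l := by
  have hsq (y : EuclideanSpace ℝ (Fin n)) : ∑ i ∈ S, y i ^ 2 ≤ ‖y‖ ^ 2 := by
    rw [EuclideanSpace.real_norm_sq_eq]
    exact Finset.sum_le_univ_sum_of_nonneg fun i => sq_nonneg _
  obtain ⟨y, hy, hyl⟩ := hex
  have hl : 0 ≤ l := by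
    rw [← norm_sum_smul_sq] at hyl
    exact nonneg_of_mul_nonneg_left (hyl ▸ sq_nonneg _) hy
  set T := (ContinuousLinearMap.adjoint (analysisOp F)).comp (diagOp S) with hT
  have hTT : ‖errorOp F S‖ = ‖T‖ ^ 2 := by
    have h := ContinuousLinearMap.norm_adjoint_comp_self (ContinuousLinearMap.adjoint T)
    rw [ContinuousLinearMap.adjoint_adjoint, LinearIsometryEquiv.norm_map] at h
    rw [errorOp_eq, ← hT, h, sq]
  rw [hTT]
  apply le_antisymm
  · rw [← Real.sq_sqrt hl]
    refine pow_le_pow_left₀ (norm_nonneg _) ?_ 2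
    refine ContinuousLinearMap.opNorm_le_bound _ (Real.sqrt_nonneg _) fun z => ?_
    refine le_of_sq_le_sq ?_ (by positivity)
    rw [hT, adjoint_analysisOp_comp_diagOp_apply, norm_sum_smul_sq, mul_pow, Real.sq_sqrt hl]
    exact (hle _).trans (mul_le_mul_of_nonneg_left (hsq z) hl)
  -- Cutting the extremal vector off outside S leaves its image under T unchanged and makes its norm
  -- equal to the sum over S.
  · set z : EuclideanSpace ℝ (Fin n) := WithLp.toLp 2 fun i => if i ∈ S then y i else 0 with hz
    have hzn : ‖z‖ ^ 2 = ∑ i ∈ S, y i ^ 2 := by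
      rw [EuclideanSpace.real_norm_sq_eq]
      simp [hz, ite_pow, Finset.sum_ite_mem]
    have hTz : ‖T z‖ ^ 2 = l * ‖z‖ ^ 2 := by
      rw [hT, adjoint_analysisOp_comp_diagOp_apply, hzn, ← hyl, ← norm_sum_smul_sq]
      congr 2
      exact Finset.sum_congr rfl fun i hi => by simp [hz, hi]
    have h := pow_le_pow_left₀ (norm_nonneg _) (T.le_opNorm z) 2
    rw [hTz, mul_pow] at h
    exact le_of_mul_le_mul_right h (hzn ▸ hy)

/-- The Gram matrix has diagonal r and off-diagonal entry b, with eigenvalues r ± b and eigenvectors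
(1, ±1). -/
theorem norm_errorOp_pair {n k : ℕ} (F : Fin n → EuclideanSpace ℝ (Fin k)) {i j : Fin n}
    (hij : i ≠ j) {r : ℝ} (hi : ‖F i‖ ^ 2 = r) (hj : ‖F j‖ ^ 2 = r) :
    ‖errorOp F {i, j}‖ = r + |inner ℝ (F i) (F j)| := by
  set b : ℝ := inner ℝ (F i) (F j) with hb
  have hji : inner ℝ (F j) (F i) = b := real_inner_comm _ _
  apply norm_errorOp_eq
  · intro y
    simp only [Finset.sum_pair hij, real_inner_self_eq_norm_sq, hi, hj, hji, ← hb]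
    have h1 : 2 * (y i * y j) ≤ y i ^ 2 + y j ^ 2 := by linarith [sq_nonneg (y i - y j)]
    have h2 : -(2 * (y i * y j)) ≤ y i ^ 2 + y j ^ 2 := by linarith [sq_nonneg (y i + y j)]
    rcases abs_cases b with ⟨h, h0⟩ | ⟨h, h0⟩ <;> rw [h] <;> nlinarith
  · rcases abs_cases b with ⟨h, h0⟩ | ⟨h, h0⟩
    · refine ⟨fun _ => 1, ?_, ?_⟩
      · simp [Finset.sum_pair hij]
      · simp only [Finset.sum_pair hij, real_inner_self_eq_norm_sq, hi, hj, hji, ← hb, h]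
        ring
    · refine ⟨fun m => if m = i then 1 else -1, ?_, ?_⟩
      · simp [Finset.sum_pair hij]
      · simp only [Finset.sum_pair hij, real_inner_self_eq_norm_sq, hi, hj, hji, ← hb, h, if_pos,
          if_neg hij.symm]
        ring

theorem sum_triple {n : ℕ} {i j l : Fin n} (hij : i ≠ j) (hil : i ≠ l) (hjl : j ≠ l)
    (f : Fin n → ℝ) : ∑ m ∈ {i, j, l}, f m = f i + (f j + f l) := by
  rw [Finset.sum_insert (by simp [hij, hil]), Finset.sum_pair hjl]

/-- If stu = 1, then I + Q₃ is the rank-one matrix of (1, s, t), so Q₃ has eigenvalues 2, -1, -1. If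
stu = -1, then I - Q₃ is the rank-one matrix of (1, -s, -t), and the eigenvalues are 1, 1, -2. -/
theorem norm_errorOp_triple {n k : ℕ} (F : Fin n → EuclideanSpace ℝ (Fin k)) {i j l : Fin n}
    (hij : i ≠ j) (hil : i ≠ l) (hjl : j ≠ l) {r c s t u : ℝ} (hc : 0 ≤ c)
    (hr : ∀ m, ‖F m‖ ^ 2 = r) (hs : inner ℝ (F i) (F j) = c * s)
    (ht : inner ℝ (F i) (F l) = c * t) (hu : inner ℝ (F j) (F l) = c * u)
    (hs2 : s ^ 2 = 1) (ht2 : t ^ 2 = 1) :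
    (s * t * u = 1 → ‖errorOp F {i, j, l}‖ = r + 2 * c) ∧
      (s * t * u = -1 → ‖errorOp F {i, j, l}‖ = r + c) := by
  have hs' : inner ℝ (F j) (F i) = c * s := by rw [real_inner_comm, hs]
  have ht' : inner ℝ (F l) (F i) = c * t := by rw [real_inner_comm, ht]
  have hu' : inner ℝ (F l) (F j) = c * u := by rw [real_inner_comm, hu]
  have hquad (y : Fin n → ℝ) :
      ∑ a ∈ {i, j, l}, ∑ b ∈ {i, j, l}, y a * y b * inner ℝ (F a) (F b) =
        r * (y i ^ 2 + (y j ^ 2 + y l ^ 2)) +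
          c * (2 * (s * (y i * y j) + t * (y i * y l) + u * (y j * y l))) := by
    simp only [sum_triple hij hil hjl, real_inner_self_eq_norm_sq, hr, hs, ht, hu, hs', ht', hu']
    ring
  constructor
  · intro hstu
    have hu1 : u = s * t := by linear_combination (-u * t ^ 2) * hs2 - u * ht2 + s * t * hstu
    apply norm_errorOp_eq
    · intro y
      rw [hquad, sum_triple hij hil hjl, add_mul, mul_comm 2 c, mul_assoc]
      refine add_le_add le_rfl (mul_le_mul_of_nonneg_left ?_ hc)
      have e : 2 * (2 * (y i ^ 2 + (y j ^ 2 + y l ^ 2))) -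
          2 * (2 * (s * (y i * y j) + t * (y i * y l) + u * (y j * y l))) =
          2 * ((y i - s * y j) ^ 2 + (y i - t * y l) ^ 2 + (s * y j - t * y l) ^ 2) := by
        rw [hu1]
        linear_combination (-4 * y j ^ 2) * hs2 - 4 * y l ^ 2 * ht2
      have : 0 ≤ 2 * ((y i - s * y j) ^ 2 + (y i - t * y l) ^ 2 + (s * y j - t * y l) ^ 2) := by
        positivity
      linarith
    · refine ⟨fun m => if m = i then 1 else if m = j then s else t, ?_, ?_⟩
      · simp [sum_triple hij hil hjl, hij.symm, hil.symm, hjl.symm]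
        positivity
      · rw [hquad, sum_triple hij hil hjl]
        simp only [if_pos, if_neg hij.symm, if_neg hil.symm, if_neg hjl.symm, hu1]
        linear_combination (2 * c * t ^ 2) * hs2 + 2 * c * ht2
  · intro hstu
    have hu1 : u = -(s * t) := by linear_combination (-u * t ^ 2) * hs2 - u * ht2 + s * t * hstu
    apply norm_errorOp_eq
    · intro y
      rw [hquad, sum_triple hij hil hjl, add_mul]
      refine add_le_add le_rfl (mul_le_mul_of_nonneg_left ?_ hc)
      have e : (y i ^ 2 + (y j ^ 2 + y l ^ 2)) -
          2 * (s * (y i * y j) + t * (y i * y l) + u * (y j * y l)) =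
          (y i - s * y j - t * y l) ^ 2 := by
        rw [hu1]
        linear_combination (-y j ^ 2) * hs2 - y l ^ 2 * ht2
      linarith [sq_nonneg (y i - s * y j - t * y l)]
    -- Any vector orthogonal to (1, -s, -t) is extremal; (1, s, 0) is one.
    · refine ⟨fun m => if m = i then 1 else if m = j then s else 0, ?_, ?_⟩
      · simp [sum_triple hij hil hjl, hij.symm, hil.symm, hjl.symm]
        positivity
      · rw [hquad, sum_triple hij hil hjl]
        simp only [if_pos, if_neg hij.symm, if_neg hil.symm, if_neg hjl.symm]
        linear_combination c * hs2

/-! ### Parseval identities and equiangularity -/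

theorem IsParsevalFrame.sum_inner_mul_inner {n k : ℕ} {F : Fin n → EuclideanSpace ℝ (Fin k)}
    (hF : IsParsevalFrame F) (x y : EuclideanSpace ℝ (Fin k)) :
    ∑ j, inner ℝ x (F j) * inner ℝ (F j) y = inner ℝ x y := by
  have h1 := hF (x + y)
  have h2 := hF x
  have h3 := hF y
  simp only [sq_abs] at h1 h2 h3
  have h4 := norm_add_sq_real x y
  rw [← h1, ← h2, ← h3] at h4
  simp only [inner_add_left, add_sq, Finset.sum_add_distrib] at h4
  have h5 : ∑ j, 2 * inner ℝ x (F j) * inner ℝ y (F j) =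
      2 * ∑ j, inner ℝ x (F j) * inner ℝ (F j) y := by
    rw [Finset.mul_sum]
    exact Finset.sum_congr rfl fun j _ => by rw [real_inner_comm y]; ring
  linarith

/-- This is tr V*V = tr I: sum the Parseval identity over the standard basis. -/
theorem IsParsevalFrame.sum_norm_sq {n k : ℕ} {F : Fin n → EuclideanSpace ℝ (Fin k)}
    (hF : IsParsevalFrame F) : ∑ j, ‖F j‖ ^ 2 = k := by
  have h (i : Fin k) : ∑ j, F j i ^ 2 = 1 := by
    have := hF (EuclideanSpace.single i 1)
    simpa [sq_abs, EuclideanSpace.inner_single_left] using this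
  simp only [EuclideanSpace.real_norm_sq_eq]
  rw [Finset.sum_comm]
  simp [h]

theorem IsTwoUniformFrame.norm_sq {n k : ℕ} {F : Fin n → EuclideanSpace ℝ (Fin k)}
    (hn : 3 ≤ n) (hF : IsTwoUniformFrame F) (j : Fin n) : ‖F j‖ ^ 2 = k / n := by
  obtain ⟨hP, ⟨c, hc⟩, -⟩ := hF
  have h := hP.sum_norm_sq
  simp only [hc, Finset.sum_const, Finset.card_univ, Fintype.card_fin, nsmul_eq_mul] at h
  have : (n : ℝ) ≠ 0 := by positivity
  rw [hc, ← h]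
  field_simp

/-- The pair norms force one common modulus b for all inner products; Parseval at fᵢ then reads r² +
(n-1)b² = r. -/
theorem IsTwoUniformFrame.inner_sq {n k : ℕ} {F : Fin n → EuclideanSpace ℝ (Fin k)}
    (hn : 3 ≤ n) (hF : IsTwoUniformFrame F) {i j : Fin n} (hij : i ≠ j) :
    inner ℝ (F i) (F j) ^ 2 = (k : ℝ) * ((n : ℝ) - k) / ((n : ℝ) ^ 2 * ((n : ℝ) - 1)) := by
  have hr := hF.norm_sq hn
  obtain ⟨hP, -, c, hc⟩ := hF
  have habs (a b : Fin n) (hab : a ≠ b) : inner ℝ (F a) (F b) ^ 2 = (c - k / n) ^ 2 := by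
    have h := norm_errorOp_pair F hab (hr a) (hr b)
    rw [hc _ (Finset.card_pair hab)] at h
    rw [h, add_sub_cancel_left, sq_abs]
  have h := hP (F i)
  simp only [sq_abs] at h
  rw [← Finset.add_sum_erase _ _ (Finset.mem_univ i),
    Finset.sum_congr rfl fun b hb => habs i b (Finset.ne_of_mem_erase hb).symm,
    Finset.sum_const, Finset.card_erase_of_mem (Finset.mem_univ i), Finset.card_univ,
    Fintype.card_fin, real_inner_self_eq_norm_sq, hr, nsmul_eq_mul,
    Nat.cast_sub (by omega), Nat.cast_one] at h
  rw [habs i j hij]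
  have h3 : (3 : ℝ) ≤ n := by exact_mod_cast hn
  have h0 : (n : ℝ) ≠ 0 := by positivity
  have h1 : (n : ℝ) - 1 ≠ 0 := by linarith
  rw [eq_div_iff (by positivity)]
  have h2 : ((n : ℝ) - 1) * (c - k / n) ^ 2 = k / n - (k / n) ^ 2 := by linarith
  calc _ = (n : ℝ) ^ 2 * (((n : ℝ) - 1) * (c - k / n) ^ 2) := by ring
    _ = _ := by rw [h2]; field_simp

theorem IsTwoUniformFrame.abs_inner {n k : ℕ} {F : Fin n → EuclideanSpace ℝ (Fin k)}
    (hn : 3 ≤ n) (hF : IsTwoUniformFrame F) {i j : Fin n} (hij : i ≠ j) :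
    |inner ℝ (F i) (F j)| = frameAngle n k := by
  rw [frameAngle, ← hF.inner_sq hn hij, Real.sqrt_sq_eq_abs]

theorem IsTwoUniformFrame.le {n k : ℕ} {F : Fin n → EuclideanSpace ℝ (Fin k)}
    (hn : 3 ≤ n) (hF : IsTwoUniformFrame F) : k ≤ n := by
  have hi : (⟨0, by omega⟩ : Fin n) ≠ ⟨1, by omega⟩ := by simp
  have h := hF.inner_sq hn hi
  by_contra! hk
  have h3 : (3 : ℝ) ≤ n := by exact_mod_cast hn
  have hk' : (n : ℝ) < k := by exact_mod_cast hk
  have : (k : ℝ) * ((n : ℝ) - k) / ((n : ℝ) ^ 2 * ((n : ℝ) - 1)) < 0 :=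
    div_neg_of_neg_of_pos (mul_neg_of_pos_of_neg (by linarith) (by linarith))
      (mul_pos (by positivity) (by linarith))
  rw [← h] at this
  exact absurd this (not_lt.2 (sq_nonneg _))

theorem frameAngle_pos {n k : ℕ} (hn : 3 ≤ n) (hk : 1 ≤ k) (hkn : k < n) :
    0 < frameAngle n k := by
  have h3 : (3 : ℝ) ≤ n := by exact_mod_cast hn
  have hk1 : (1 : ℝ) ≤ k := by exact_mod_cast hk
  have hk' : (k : ℝ) < n := by exact_mod_cast hkn
  exact Real.sqrt_pos.2 (div_pos (mul_pos (by linarith) (by linarith))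
    (mul_pos (by positivity) (by linarith)))

/-! ### Seidel matrices and the graph of a frame -/

theorem seidelMatrix_self {V : Type*} (G : SimpleGraph V) (i : V) : seidelMatrix G i i = 0 := by
  simp [seidelMatrix]

theorem seidelMatrix_adj {V : Type*} (G : SimpleGraph V) {i j : V} (h : G.Adj i j) :
    seidelMatrix G i j = -1 := by
  simp [seidelMatrix, h, h.ne]

theorem seidelMatrix_not_adj {V : Type*} (G : SimpleGraph V) {i j : V} (hij : i ≠ j)
    (h : ¬ G.Adj i j) : seidelMatrix G i j = 1 := by
  simp [seidelMatrix, h, hij]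

theorem seidelMatrix_sq {V : Type*} (G : SimpleGraph V) {i j : V} (hij : i ≠ j) :
    seidelMatrix G i j ^ 2 = 1 := by
  by_cases h : G.Adj i j
  · simp [seidelMatrix_adj G h]
  · simp [seidelMatrix_not_adj G hij h]

theorem seidelMatrix_comm {V : Type*} (G : SimpleGraph V) (i j : V) :
    seidelMatrix G i j = seidelMatrix G j i := by
  by_cases hij : i = j
  · rw [hij]
  by_cases h : G.Adj i j
  · rw [seidelMatrix_adj G h, seidelMatrix_adj G h.symm]
  · rw [seidelMatrix_not_adj G hij h, seidelMatrix_not_adj G (Ne.symm hij) (mt SimpleGraph.Adj.symm h)]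

theorem isGraphOfFrame_iff {n k : ℕ} (hn : 3 ≤ n) {F : Fin n → EuclideanSpace ℝ (Fin k)}
    (hF : IsTwoUniformFrame F) (G : SimpleGraph (Fin n)) :
    IsGraphOfFrame F G ↔
      ∀ i j, i ≠ j → inner ℝ (F i) (F j) = frameAngle n k * seidelMatrix G i j := by
  constructor
  · intro h i j hij
    have := congrFun (congrFun h i) j
    rw [real_inner_comm]
    simpa [hij] using this
  · intro h
    ext i j
    by_cases hij : i = j
    · subst hij
      simp [hF.norm_sq hn, seidelMatrix_self]
    · simp [hij, real_inner_comm, h i j hij]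

/-- Adjacency is negativity of the inner product. If k = n, then c = 0 and every graph would do,
which is why uniqueness needs k < n. -/
theorem IsTwoUniformFrame.exists_graph {n k : ℕ} (hn : 3 ≤ n)
    {F : Fin n → EuclideanSpace ℝ (Fin k)} (hF : IsTwoUniformFrame F) :
    ∃ G : SimpleGraph (Fin n), IsGraphOfFrame F G := by
  let G : SimpleGraph (Fin n) :=
    { Adj := fun i j => i ≠ j ∧ inner ℝ (F i) (F j) < (0 : ℝ)
      symm := ⟨fun i j h => ⟨h.1.symm, by rw [real_inner_comm]; exact h.2⟩⟩
      loopless := ⟨fun i h => h.1 rfl⟩ }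
  refine ⟨G, (isGraphOfFrame_iff hn hF G).2 fun i j hij => ?_⟩
  rw [← hF.abs_inner hn hij]
  by_cases h : inner ℝ (F i) (F j) < (0 : ℝ)
  · rw [seidelMatrix_adj G ⟨hij, h⟩, abs_of_neg h]
    ring
  · rw [seidelMatrix_not_adj G hij fun h' => h h'.2, abs_of_nonneg (not_lt.1 h), mul_one]

theorem IsGraphOfFrame.unique {n k : ℕ} (hn : 3 ≤ n) (hk : 1 ≤ k) (hkn : k < n)
    {F : Fin n → EuclideanSpace ℝ (Fin k)} (hF : IsTwoUniformFrame F)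
    {G H : SimpleGraph (Fin n)} (hG : IsGraphOfFrame F G) (hH : IsGraphOfFrame F H) : G = H := by
  have hc := frameAngle_pos hn hk hkn
  have hG := (isGraphOfFrame_iff hn hF G).1 hG
  have hH := (isGraphOfFrame_iff hn hF H).1 hH
  ext i j
  by_cases hij : i = j
  · simp [hij]
  have h : seidelMatrix G i j = seidelMatrix H i j :=
    mul_left_cancel₀ hc.ne' ((hG i j hij).symm.trans (hH i j hij))
  by_cases h1 : G.Adj i j <;> by_cases h2 : H.Adj i j <;> simp only [h1, h2]
  · rw [seidelMatrix_adj G h1, seidelMatrix_not_adj H hij h2] at h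
    norm_num at h
  · rw [seidelMatrix_not_adj G hij h1, seidelMatrix_adj H h2] at h
    norm_num at h

/-! ### Parity of the edge number on three vertices -/

open Classical in
theorem SimpleGraph.two_mul_ncard_edgeSet_fin_three (H : SimpleGraph (Fin 3)) :
    2 * H.edgeSet.ncard = 2 * ((if H.Adj 0 1 then 1 else 0) + (if H.Adj 0 2 then 1 else 0) +
      (if H.Adj 1 2 then 1 else 0)) := by
  rw [Set.ncard_eq_toFinset_card', ← SimpleGraph.edgeFinset,
    ← H.sum_degrees_eq_twice_card_edges]
  simp only [← SimpleGraph.card_neighborFinset_eq_degree, SimpleGraph.neighborFinset_eq_filter,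
    Finset.card_filter, Fin.sum_univ_three, SimpleGraph.irrefl, if_false]
  rw [H.adj_comm 1 0, H.adj_comm 2 0, H.adj_comm 2 1]
  ring

/-- The product of the signs is (-1) to the number of edges. A complete bipartite graph on three
vertices has 0·3 or 1·2 edges, and conversely 0 or 2 edges force this shape. -/
theorem SimpleGraph.even_ncard_edgeSet_fin_three (H : SimpleGraph (Fin 3)) :
    (Even H.edgeSet.ncard ↔ IsCompleteBipartiteGraph H) ∧
    (Even H.edgeSet.ncard ↔ seidelMatrix H 0 1 * seidelMatrix H 0 2 * seidelMatrix H 1 2 = 1) ∧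
    (Odd H.edgeSet.ncard ↔ seidelMatrix H 0 1 * seidelMatrix H 0 2 * seidelMatrix H 1 2 = -1) := by
  classical
  have h := Nat.eq_of_mul_eq_mul_left two_pos H.two_mul_ncard_edgeSet_fin_three
  rw [h]
  have h10 := H.adj_comm 1 0
  have h20 := H.adj_comm 2 0
  have h21 := H.adj_comm 2 1
  -- The part containing vertex 0 must be the set of its non-neighbours, 0 included.
  refine ⟨⟨fun he => ⟨{w | ¬ H.Adj 0 w}, ?_⟩, ?_⟩, ?_⟩
  · intro u v
    fin_cases u <;> fin_cases v <;> by_cases h1 : H.Adj 0 1 <;> by_cases h2 : H.Adj 0 2 <;>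
      by_cases h3 : H.Adj 1 2 <;> simp_all <;> revert he <;> decide
  · rintro ⟨A, hA⟩
    rw [hA 0 1, hA 0 2, hA 1 2]
    by_cases h0 : (0 : Fin 3) ∈ A <;> by_cases h1 : (1 : Fin 3) ∈ A <;>
      by_cases h2 : (2 : Fin 3) ∈ A <;> simp [h0, h1, h2]
  · by_cases h1 : H.Adj 0 1 <;> by_cases h2 : H.Adj 0 2 <;> by_cases h3 : H.Adj 1 2 <;>
      simp [seidelMatrix, h1, h2, h3] <;> norm_num

theorem IsCompleteBipartiteGraph.of_iso {V W : Type*} {G : SimpleGraph V} {H : SimpleGraph W}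
    (e : G ≃g H) (hG : IsCompleteBipartiteGraph G) : IsCompleteBipartiteGraph H := by
  obtain ⟨A, hA⟩ := hG
  refine ⟨{w | e.symm w ∈ A}, fun u v => ?_⟩
  rw [← e.symm.map_adj_iff, hA]
  rfl

theorem induce_triple_parity {n : ℕ} (G : SimpleGraph (Fin n)) {i j l : Fin n}
    (hij : i ≠ j) (hil : i ≠ l) (hjl : j ≠ l) :
    (Even (G.induce (({i, j, l} : Finset (Fin n)) : Set (Fin n))).edgeSet.ncard ↔
      IsCompleteBipartiteGraph (G.induce (({i, j, l} : Finset (Fin n)) : Set (Fin n)))) ∧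
    (Even (G.induce (({i, j, l} : Finset (Fin n)) : Set (Fin n))).edgeSet.ncard ↔
      seidelMatrix G i j * seidelMatrix G i l * seidelMatrix G j l = 1) ∧
    (Odd (G.induce (({i, j, l} : Finset (Fin n)) : Set (Fin n))).edgeSet.ncard ↔
      seidelMatrix G i j * seidelMatrix G i l * seidelMatrix G j l = -1) := by
  have hinj : Function.Injective ![i, j, l] := by
    intro a b
    fin_cases a <;> fin_cases b <;> simp [hij, hil, hjl, hij.symm, hil.symm, hjl.symm]
  have hrange : Set.range ![i, j, l] = (({i, j, l} : Finset (Fin n)) : Set (Fin n)) := by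
    ext m
    simp [eq_comm]
    tauto
  let f : Fin 3 ≃ (({i, j, l} : Finset (Fin n)) : Set (Fin n)) :=
    (Equiv.ofInjective _ hinj).trans (Equiv.setCongr hrange)
  let H : SimpleGraph (Fin 3) := G.comap ![i, j, l]
  let e : H ≃g G.induce (({i, j, l} : Finset (Fin n)) : Set (Fin n)) :=
    { toEquiv := f, map_rel_iff' := Iff.rfl }
  have hcard : (G.induce (({i, j, l} : Finset (Fin n)) : Set (Fin n))).edgeSet.ncard =
      H.edgeSet.ncard := by
    rw [← Nat.card_coe_set_eq, ← Nat.card_coe_set_eq]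
    exact Nat.card_congr e.mapEdgeSet.symm
  have hS (a b : Fin 3) : seidelMatrix H a b = seidelMatrix G (![i, j, l] a) (![i, j, l] b) := by
    by_cases hab : a = b
    · rw [hab, seidelMatrix_self, seidelMatrix_self]
    by_cases h : H.Adj a b
    · rw [seidelMatrix_adj H h, seidelMatrix_adj G h]
    · rw [seidelMatrix_not_adj H hab h, seidelMatrix_not_adj G (hinj.ne hab) h]
  have h := H.even_ncard_edgeSet_fin_three
  rw [hcard, ← show IsCompleteBipartiteGraph H ↔ _ from ⟨.of_iso e, .of_iso e.symm⟩]
  simp only [hS] at h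
  exact h

/-! ### Counting triples -/

/-- Counting `m`-subsets as finsets or as sets gives the same number. -/
theorem card_filter_coe_powersetCard {n m : ℕ} (P : Set (Fin n) → Prop)
    (T : Finset (Set (Fin n)))
    (hT : ∀ A, A ∈ T ↔ (∃ S ∈ Finset.powersetCard m (Finset.univ : Finset (Fin n)), ↑S = A) ∧ P A)
    [DecidablePred fun S : Finset (Fin n) => P S] :
    T.card = ((Finset.powersetCard m (Finset.univ : Finset (Fin n))).filter
      fun S : Finset (Fin n) => P S).card := by
  symm
  refine Finset.card_bij (fun S _ => (S : Set (Fin n))) (fun S hS => ?_)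
    (fun _ _ _ _ h => Finset.coe_injective h) fun A hA => ?_
  · obtain ⟨hS, hP⟩ := Finset.mem_filter.1 hS
    exact (hT _).2 ⟨⟨S, hS, rfl⟩, hP⟩
  · obtain ⟨⟨S, hS, rfl⟩, hP⟩ := (hT A).1 hA
    exact ⟨S, Finset.mem_filter.2 ⟨hS, hP⟩, rfl⟩

-- In the definitions of the three counts the filter variable elaborates as a `Set (Fin n)`, with
-- the family of finsets coerced accordingly; these lemmas return to finsets.
open Classical in
theorem numBipartite3_eq_card {n : ℕ} (G : SimpleGraph (Fin n)) :
    numBipartite3 G = ((Finset.powersetCard 3 (Finset.univ : Finset (Fin n))).filter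
      fun S : Finset (Fin n) => IsCompleteBipartiteGraph (G.induce (S : Set (Fin n)))).card :=
  card_filter_coe_powersetCard (fun A => IsCompleteBipartiteGraph (G.induce A)) _ fun A => by
    simp [eq_comm]

open Classical in
theorem numEven3_eq_card {n : ℕ} (G : SimpleGraph (Fin n)) :
    numEven3 G = ((Finset.powersetCard 3 (Finset.univ : Finset (Fin n))).filter
      fun S : Finset (Fin n) => Even (G.induce (S : Set (Fin n))).edgeSet.ncard).card :=
  card_filter_coe_powersetCard (fun A => Even (G.induce A).edgeSet.ncard) _ fun A => by
    simp [eq_comm]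

open Classical in
theorem numOdd3_eq_card {n : ℕ} (G : SimpleGraph (Fin n)) :
    numOdd3 G = ((Finset.powersetCard 3 (Finset.univ : Finset (Fin n))).filter
      fun S : Finset (Fin n) => Odd (G.induce (S : Set (Fin n))).edgeSet.ncard).card :=
  card_filter_coe_powersetCard (fun A => Odd (G.induce A).edgeSet.ncard) _ fun A => by
    simp [eq_comm]

theorem numBipartite3_eq_numEven3 {n : ℕ} (G : SimpleGraph (Fin n)) :
    numBipartite3 G = numEven3 G := by
  classical
  rw [numBipartite3_eq_card, numEven3_eq_card]
  congr 1
  refine Finset.filter_congr fun S hS => ?_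
  obtain ⟨i, j, l, hij, hil, hjl, rfl⟩ := Finset.card_eq_three.1 (Finset.mem_powersetCard.1 hS).2
  exact (induce_triple_parity G hij hil hjl).1.symm

/-- A sum over all 3-sets of a function that depends only on the parity of the edge number. -/
theorem sum_powersetCard_three_eq {n : ℕ} (G : SimpleGraph (Fin n)) (f : Finset (Fin n) → ℝ)
    (a b : ℝ)
    (ha : ∀ i j l, i ≠ j → i ≠ l → j ≠ l →
      seidelMatrix G i j * seidelMatrix G i l * seidelMatrix G j l = 1 → f {i, j, l} = a)
    (hb : ∀ i j l, i ≠ j → i ≠ l → j ≠ l →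
      seidelMatrix G i j * seidelMatrix G i l * seidelMatrix G j l = -1 → f {i, j, l} = b) :
    ∑ S ∈ Finset.powersetCard 3 (Finset.univ : Finset (Fin n)), f S =
      a * numEven3 G + b * numOdd3 G := by
  classical
  rw [← Finset.sum_filter_add_sum_filter_not _
    (fun S : Finset (Fin n) => Even (G.induce (S : Set (Fin n))).edgeSet.ncard)]
  simp only [Nat.not_even_iff_odd]
  rw [numEven3_eq_card, numOdd3_eq_card, mul_comm a, mul_comm b, ← nsmul_eq_mul, ← nsmul_eq_mul,
    ← Finset.sum_const, ← Finset.sum_const]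
  congr 1
  · refine Finset.sum_congr (by congr!) fun S hS => ?_
    obtain ⟨hS, he⟩ := Finset.mem_filter.1 hS
    obtain ⟨i, j, l, hij, hil, hjl, rfl⟩ := Finset.card_eq_three.1 (Finset.mem_powersetCard.1 hS).2
    exact ha i j l hij hil hjl ((induce_triple_parity G hij hil hjl).2.1.1 he)
  · refine Finset.sum_congr (by congr!) fun S hS => ?_
    obtain ⟨hS, ho⟩ := Finset.mem_filter.1 hS
    obtain ⟨i, j, l, hij, hil, hjl, rfl⟩ := Finset.card_eq_three.1 (Finset.mem_powersetCard.1 hS).2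
    exact hb i j l hij hil hjl ((induce_triple_parity G hij hil hjl).2.2.1 ho)

theorem numEven3_add_numOdd3 {n : ℕ} (G : SimpleGraph (Fin n)) :
    (numEven3 G : ℝ) + numOdd3 G = n.choose 3 := by
  have h := sum_powersetCard_three_eq G (fun _ => 1) 1 1 (fun _ _ _ _ _ _ _ => rfl)
    (fun _ _ _ _ _ _ _ => rfl)
  simpa using h.symm

/-- A sum over ordered triples, for a function vanishing at triples with a repetition. -/
theorem sum_triples_eq_sum_powersetCard {n : ℕ} (f : Fin n → Fin n → Fin n → ℝ)
    (hf : ∀ i j l, ¬ (i ≠ j ∧ i ≠ l ∧ j ≠ l) → f i j l = 0) :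
    ∑ i, ∑ j, ∑ l, f i j l =
      ∑ S ∈ Finset.powersetCard 3 (Finset.univ : Finset (Fin n)),
        ∑ i ∈ S, ∑ j ∈ S, ∑ l ∈ S, f i j l := by
  have h1 (S : Finset (Fin n)) : ∑ i ∈ S, ∑ j ∈ S, ∑ l ∈ S, f i j l =
      ∑ i, ∑ j, ∑ l, if {i, j, l} ⊆ S then f i j l else 0 := by
    simp only [Finset.insert_subset_iff, Finset.singleton_subset_iff, ite_and,
      Finset.sum_ite_irrel, Finset.sum_ite_mem, Finset.univ_inter, Finset.sum_const_zero]
  simp_rw [h1]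
  symm
  rw [Finset.sum_comm]
  refine Finset.sum_congr rfl fun i _ => ?_
  rw [Finset.sum_comm]
  refine Finset.sum_congr rfl fun j _ => ?_
  rw [Finset.sum_comm]
  refine Finset.sum_congr rfl fun l _ => ?_
  by_cases h : i ≠ j ∧ i ≠ l ∧ j ≠ l
  · have hc : ({i, j, l} : Finset (Fin n)).card = 3 :=
      Finset.card_eq_three.2 ⟨i, j, l, h.1, h.2.1, h.2.2, rfl⟩
    rw [Finset.sum_eq_single {i, j, l}]
    · simp
    · intro S hS hne
      rw [if_neg]
      intro hsub
      exact hne (Finset.eq_of_subset_of_card_le hsub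
        (by rw [(Finset.mem_powersetCard.1 hS).2, hc])).symm
    · intro hS
      exact absurd (Finset.mem_powersetCard.2 ⟨Finset.subset_univ _, hc⟩) hS
  · simp [hf i j l h]

/-- Each 3-set contributes its six orderings, all with the same sign product; triples with a
repetition vanish by the zero diagonal. -/
theorem sum_seidelMatrix_triple {n : ℕ} (G : SimpleGraph (Fin n)) :
    ∑ i, ∑ j, ∑ l, seidelMatrix G i j * seidelMatrix G j l * seidelMatrix G l i =
      6 * ((numEven3 G : ℝ) - numOdd3 G) := by
  rw [sum_triples_eq_sum_powersetCard fun i j l =>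
    seidelMatrix G i j * seidelMatrix G j l * seidelMatrix G l i,
    sum_powersetCard_three_eq G _ 6 (-6)]
  · ring
  · intro i j l hij hil hjl h
    simp only [sum_triple hij hil hjl, seidelMatrix_self, seidelMatrix_comm G j i,
      seidelMatrix_comm G l i, seidelMatrix_comm G l j]
    linear_combination 6 * h
  · intro i j l hij hil hjl h
    simp only [sum_triple hij hil hjl, seidelMatrix_self, seidelMatrix_comm G j i,
      seidelMatrix_comm G l i, seidelMatrix_comm G l j]
    linear_combination 6 * h
  · intro i j l h
    by_cases hij : i = j
    · simp [hij, seidelMatrix_self]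
    by_cases hil : i = l
    · simp [hil, seidelMatrix_self]
    have hjl : j = l := by tauto
    simp [hjl, seidelMatrix_self]

/-! ### Traces and the values of the counts -/

theorem IsGraphOfFrame.sq_eq {n k : ℕ} {F : Fin n → EuclideanSpace ℝ (Fin k)}
    (hF : IsParsevalFrame F) {G : SimpleGraph (Fin n)} (hG : IsGraphOfFrame F G) :
    let P := ((k : ℝ) / n) • (1 : Matrix (Fin n) (Fin n) ℝ) + frameAngle n k • seidelMatrix G
    P * P = P := by
  intro P
  have hP : (Matrix.of fun i j => (inner ℝ (F j) (F i) : ℝ)) = P := hG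
  rw [← hP]
  ext i j
  rw [Matrix.mul_apply]
  simp only [Matrix.of_apply]
  rw [← hF.sum_inner_mul_inner (F j) (F i)]
  exact Finset.sum_congr rfl fun l _ => mul_comm _ _

theorem trace_seidelMatrix {n : ℕ} (G : SimpleGraph (Fin n)) : (seidelMatrix G).trace = 0 := by
  simp [Matrix.trace, seidelMatrix_self]

theorem trace_seidelMatrix_sq {n : ℕ} (G : SimpleGraph (Fin n)) :
    (seidelMatrix G * seidelMatrix G).trace = n * ((n : ℝ) - 1) := by
  have h (i : Fin n) : ∑ j, seidelMatrix G i j * seidelMatrix G j i = (n : ℝ) - 1 := by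
    have hn : 1 ≤ n := i.pos
    rw [← Finset.add_sum_erase _ _ (Finset.mem_univ i),
      Finset.sum_congr rfl fun b hb => (by
        rw [seidelMatrix_comm G b i, ← sq, seidelMatrix_sq G (Finset.ne_of_mem_erase hb).symm] :
        seidelMatrix G i b * seidelMatrix G b i = 1)]
    simp [seidelMatrix_self, Nat.cast_sub hn]
  simp only [Matrix.trace, Matrix.diag_apply, Matrix.mul_apply, h, Finset.sum_const,
    Finset.card_univ, Fintype.card_fin, nsmul_eq_mul]

theorem trace_seidelMatrix_cube {n : ℕ} (G : SimpleGraph (Fin n)) :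
    (seidelMatrix G * (seidelMatrix G * seidelMatrix G)).trace =
      6 * ((numEven3 G : ℝ) - numOdd3 G) := by
  rw [← sum_seidelMatrix_triple]
  simp [Matrix.trace, Matrix.mul_apply, Finset.mul_sum, mul_assoc]

theorem frameAngle_sq {n k : ℕ} (hn : 3 ≤ n) (hkn : k ≤ n) :
    frameAngle n k ^ 2 * ((n : ℝ) - 1) = (k : ℝ) / n * (1 - k / n) := by
  have h3 : (3 : ℝ) ≤ n := by exact_mod_cast hn
  have hk' : (k : ℝ) ≤ n := by exact_mod_cast hkn
  have h1 : (0 : ℝ) < (n : ℝ) - 1 := by linarith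
  have h2 : (0 : ℝ) ≤ (n : ℝ) - k := by linarith
  rw [frameAngle, Real.sq_sqrt (by positivity)]
  field_simp

/-- The trace of the cube of the Gram matrix determines `E₃ - O₃`. -/
theorem IsGraphOfFrame.frameAngle_mul_sub {n k : ℕ} (hn : 3 ≤ n) (hk : 1 ≤ k) (hkn : k < n)
    {F : Fin n → EuclideanSpace ℝ (Fin k)} (hF : IsTwoUniformFrame F)
    {G : SimpleGraph (Fin n)} (hG : IsGraphOfFrame F G) :
    frameAngle n k * (6 * ((numEven3 G : ℝ) - numOdd3 G)) =
      n * ((n : ℝ) - 1) * (1 - 2 * (k / n)) := by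
  have hP := IsGraphOfFrame.sq_eq hF.1 hG
  have hc := frameAngle_pos hn hk hkn
  have hc2 := frameAngle_sq hn hkn.le
  have ht1 := trace_seidelMatrix G
  have ht2 := trace_seidelMatrix_sq G
  have ht3 := trace_seidelMatrix_cube G
  set Q := seidelMatrix G
  set c := frameAngle n k
  set r : ℝ := (k : ℝ) / n
  simp only at hP
  have e2 : (r • (1 : Matrix (Fin n) (Fin n) ℝ) + c • Q) *
      ((r • (1 : Matrix (Fin n) (Fin n) ℝ) + c • Q) *
        (r • (1 : Matrix (Fin n) (Fin n) ℝ) + c • Q)) =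
      r ^ 3 • (1 : Matrix (Fin n) (Fin n) ℝ) + (3 * r ^ 2 * c) • Q + (3 * r * c ^ 2) • (Q * Q) +
        c ^ 3 • (Q * (Q * Q)) := by
    simp only [add_mul, mul_add, smul_mul_assoc, mul_smul_comm, one_mul, mul_one]
    module
  have h5 := congrArg Matrix.trace e2
  rw [hP, hP] at h5
  simp only [Matrix.trace_add, Matrix.trace_smul, Matrix.trace_one, Fintype.card_fin, ht1, ht2,
    ht3, smul_eq_mul] at h5
  -- With c²(n-1) = r(1-r), the trace identity becomes c³ tr Q³ = nr(1-r)(1-2r) = c² n(n-1)(1-2r);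
  -- cancel c².
  apply mul_left_cancel₀ (pow_ne_zero 2 hc.ne')
  linear_combination -h5 - (3 * r * n + n * (1 - 2 * r)) * hc2

/-- Since P = r I + c Q has eigenvalues 1 and 0, those of Q are (1-r)/c and -r/c; the two roots are
their absolute values. -/
theorem sqrt_eq_div_frameAngle {n k : ℕ} (hn : 3 ≤ n) (hk : 1 ≤ k) (hkn : k < n) :
    Real.sqrt (((n : ℝ) - k) * ((n : ℝ) - 1) / k) = (1 - k / n) / frameAngle n k ∧
      Real.sqrt ((k : ℝ) * ((n : ℝ) - 1) / ((n : ℝ) - k)) = k / n / frameAngle n k := by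
  have h3 : (3 : ℝ) ≤ n := by exact_mod_cast hn
  have hk1 : (1 : ℝ) ≤ k := by exact_mod_cast hk
  have hk' : (k : ℝ) < n := by exact_mod_cast hkn
  have hc := frameAngle_pos hn hk hkn
  have hc2 := frameAngle_sq hn hkn.le
  have h0 : (0 : ℝ) < n := by linarith
  have h1 : (0 : ℝ) < (n : ℝ) - 1 := by linarith
  have h2 : (0 : ℝ) < (n : ℝ) - k := by linarith
  have h4 : (0 : ℝ) ≤ 1 - k / n := by
    rw [sub_nonneg, div_le_one h0]
    exact hk'.le
  have hc3 : frameAngle n k ^ 2 = (k : ℝ) * (n - k) / (n ^ 2 * (n - 1)) :=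
    Real.sq_sqrt (by positivity)
  constructor
  · rw [Real.sqrt_eq_iff_eq_sq (by positivity) (by positivity), div_pow, hc3]
    field_simp
  · rw [Real.sqrt_eq_iff_eq_sq (by positivity) (by positivity), div_pow, hc3]
    field_simp

theorem IsGraphOfFrame.numEven3_eq_and_numOdd3_eq {n k : ℕ} (hn : 3 ≤ n) (hk : 1 ≤ k)
    (hkn : k < n) {F : Fin n → EuclideanSpace ℝ (Fin k)} (hF : IsTwoUniformFrame F)
    {G : SimpleGraph (Fin n)} (hG : IsGraphOfFrame F G) :
    (numEven3 G : ℝ) = evenConst n k ∧ (numOdd3 G : ℝ) = oddConst n k := by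
  have hsum := numEven3_add_numOdd3 G
  have hdiff := hG.frameAngle_mul_sub hn hk hkn hF
  obtain ⟨ha, hb⟩ := sqrt_eq_div_frameAngle hn hk hkn
  have hc := frameAngle_pos hn hk hkn
  have hc2 := frameAngle_sq hn hkn.le
  have hch : (n.choose 3 : ℝ) = n * (n - 1) * (n - 2) / 6 := by
    -- This removes the truncated subtraction n - (3 - 1) from the Pochhammer formula.
    obtain ⟨m, rfl⟩ : ∃ m, n = m + 2 := ⟨n - 2, by omega⟩
    rw [Nat.cast_choose_eq_ascPochhammer_div]
    simp [ascPochhammer_succ_left, Nat.factorial]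
    ring
  have hodd : (numOdd3 G : ℝ) = oddConst n k := by
    -- The product of the two roots is n - 1, and their difference is n - 2 - 2v, so the
    -- common-neighbour constant is affine in v.
    have hcn : commonNbrConst n k = (3 * valencyConst n k - n) / 2 := by
      unfold commonNbrConst valencyConst
      rw [ha, hb]
      have hab : (1 - k / n) / frameAngle n k * (k / n / frameAngle n k) = (n : ℝ) - 1 := by
        rw [div_mul_div_comm, div_eq_iff (by positivity)]
        linear_combination -hc2
      linear_combination (-1 / 4) * hab
    have hv : frameAngle n k * (2 * valencyConst n k) =
        frameAngle n k * (n - 2) - (1 - 2 * (k / n)) := by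
      unfold valencyConst
      rw [ha, hb]
      field_simp
      ring
    -- After this substitution the v² terms cancel and the constant is n(n-1)v/6.
    rw [oddConst, hcn]
    apply mul_left_cancel₀ hc.ne'
    linear_combination (frameAngle n k / 2) * hsum - hdiff / 12 +
      frameAngle n k / 2 * hch - n * (n - 1) / 12 * hv
  refine ⟨?_, hodd⟩
  have h : evenConst n k = n.choose 3 - oddConst n k := by
    unfold evenConst oddConst
    ring
  rw [h, ← hodd, ← hsum]
  ring

/-! ### The error for three erasures -/

theorem erasureError_three_eq {n k : ℕ} (hn : 3 ≤ n) {F : Fin n → EuclideanSpace ℝ (Fin k)}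
    (hF : IsTwoUniformFrame F) {G : SimpleGraph (Fin n)} (hG : IsGraphOfFrame F G) (p : ℝ) :
    erasureError 3 p F =
      ((n.choose 3 : ℝ)⁻¹ *
        (((k : ℝ) / n + 2 * frameAngle n k) ^ p * (numEven3 G : ℝ)
          + ((k : ℝ) / n + frameAngle n k) ^ p * (numOdd3 G : ℝ))) ^ (1 / p) := by
  have hG' := (isGraphOfFrame_iff hn hF G).1 hG
  have key {i j l : Fin n} (hij : i ≠ j) (hil : i ≠ l) (hjl : j ≠ l) :=
    norm_errorOp_triple F hij hil hjl (c := frameAngle n k)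
      (Real.sqrt_nonneg _) (hF.norm_sq hn)
      (hG' i j hij) (hG' i l hil) (hG' j l hjl) (seidelMatrix_sq G hij) (seidelMatrix_sq G hil)
  rw [erasureError, sum_powersetCard_three_eq G _ (((k : ℝ) / n + 2 * frameAngle n k) ^ p)
    (((k : ℝ) / n + frameAngle n k) ^ p)]
  · intro i j l hij hil hjl h
    rw [(key hij hil hjl).1 h]
  · intro i j l hij hil hjl h
    rw [(key hij hil hjl).2 h]

/-- For k < n the counts depend only on n and k. For k = n the angle is 0, both weights coincide,
and only E₃ + O₃ matters. -/
theorem erasureError_three_eq_of_isTwoUniformFrame {n k : ℕ} (hn : 3 ≤ n) (hk : 1 ≤ k)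
    {F₁ F₂ : Fin n → EuclideanSpace ℝ (Fin k)} (h₁ : IsTwoUniformFrame F₁)
    (h₂ : IsTwoUniformFrame F₂) (p : ℝ) : erasureError 3 p F₁ = erasureError 3 p F₂ := by
  obtain ⟨G₁, hG₁⟩ := h₁.exists_graph hn
  obtain ⟨G₂, hG₂⟩ := h₂.exists_graph hn
  rw [erasureError_three_eq hn h₁ hG₁, erasureError_three_eq hn h₂ hG₂]
  rcases (h₁.le hn).lt_or_eq with hkn | hkn
  · obtain ⟨e₁, o₁⟩ := hG₁.numEven3_eq_and_numOdd3_eq hn hk hkn h₁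
    obtain ⟨e₂, o₂⟩ := hG₂.numEven3_eq_and_numOdd3_eq hn hk hkn h₂
    rw [e₁, o₁, e₂, o₂]
  · have hc : frameAngle n k = 0 := by simp [frameAngle, hkn]
    rw [hc, mul_zero, ← mul_add, ← mul_add, numEven3_add_numOdd3, numEven3_add_numOdd3]

theorem mainTheorem5 (n k : ℕ) (hn : 3 ≤ n) (hk : 1 ≤ k) :
    (∀ F : Fin n → EuclideanSpace ℝ (Fin k), IsTwoUniformFrame F →
      (∃ G : SimpleGraph (Fin n), IsGraphOfFrame F G) ∧
      (k < n → ∃! G : SimpleGraph (Fin n), IsGraphOfFrame F G) ∧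
      ∀ G : SimpleGraph (Fin n), IsGraphOfFrame F G →
        numBipartite3 G = numEven3 G ∧
        (∀ p : ℝ, 2 ≤ p →
          erasureError 3 p F =
            ((n.choose 3 : ℝ)⁻¹ *
              (((k : ℝ) / n + 2 * frameAngle n k) ^ p * (numEven3 G : ℝ)
                + ((k : ℝ) / n + frameAngle n k) ^ p * (numOdd3 G : ℝ))) ^ (1 / p)) ∧
        (k < n →
          (numEven3 G : ℝ) = evenConst n k ∧ (numOdd3 G : ℝ) = oddConst n k)) ∧
    (∀ F₁ F₂ : Fin n → EuclideanSpace ℝ (Fin k),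
      IsTwoUniformFrame F₁ → IsTwoUniformFrame F₂ →
        ∀ p : ℝ, 2 ≤ p → erasureError 3 p F₁ = erasureError 3 p F₂) := by
  refine ⟨fun F hF => ⟨hF.exists_graph hn, fun hkn => ?_, fun G hG => ⟨numBipartite3_eq_numEven3 G,
    fun p _ => erasureError_three_eq hn hF hG p,
    fun hkn => hG.numEven3_eq_and_numOdd3_eq hn hk hkn hF⟩⟩,
    fun F₁ F₂ h₁ h₂ p _ => erasureError_three_eq_of_isTwoUniformFrame hn hk h₁ h₂ p⟩
  obtain ⟨G, hG⟩ := hF.exists_graph hn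
  exact ⟨G, hG, fun H hH => hH.unique hn hk hkn hF hG⟩
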